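/- Let $X$ be a metrizable space and let $(\Phi(t))_{t\ge 0}$ be a continuous semiflow on $X$, that is, $\Phi(0)=\mathrm{id}$, $\Phi(t_1+t_2)=\Phi(t_1)\circ\Phi(t_2)$, and $(t,u)\mapsto\Phi(t)u$ is continuous on $[0,\infty)\times X$. Suppose that it is an extended dissipative system on $\mathbb{R}^2$: to each $u\in X$ are associated functions $e,d\in C^0(\mathbb{R}^2,\mathbb{R}_+)$ and $f\in C^0(\mathbb{R}^2,\mathbb{R}^2)$ such that (A1) $e,f,d$ depend continuously on $u\in X$, for the topology of uniform convergence on compact subsets of $\mathbb{R}^2$; (A2) $|f|^2\le b(e)\,d$ for some nondecreasing function $b:\mathbb{R}_+\to\mathbb{R}_+$ that does not depend on $u$; (A3) if $d\equiv 0$, then $\Phi(t)u=u$ for all $t\ge 0$; (A4) along every trajectory $u(t)=\Phi(t)u_0$, the corresponding functions $e(x,t),f(x,t),d(x,t)$ satisfy $\partial_t e=\operatorname{div} f-d$ in the sense of distributions on $\mathbb{R}^2\times(0,\infty)$. Let $u(t)=\Phi(t)u_0$ be a trajectory such that $$e_0=\sup_{x\in\mathbb{R}^2}e(x,0)<\infty,\qquad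 \beta=\sup_{x\in\mathbb{R}^2}\sup_{t\ge 0}b(e(x,t))<\infty,$$ with $e_0>0$ and $\beta>0$. Write $B_R=\{x\in\mathbb{R}^2 : |x|<R\}$. Then: 1) If $R(T)=R_0T^{\gamma}$ with $R_0>0$ and $\gamma\in[0,1/2)$, then $$\limsup_{T\to\infty}\frac{\log T}{T}\int_0^T\!\!\int_{B_{R(T)}}d(x,t)\,dx\,dt\;\le\;\frac{4\pi\beta}{1-2\gamma}.$$ 2) If $R(T)=R_0\,T^{1/2}/\log T$ with $R_0>0$, then $$\limsup_{T\to\infty}\frac{\log\log T}{T}\int_0^T\!\!\int_{B_{R(T)}}d(x,t)\,dx\,dt\;\le\;2\pi\beta.$$ -/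

import Mathlib

open scoped NNReal ContDiff

/-- `∂ₜ e = div f - d` in the sense of distributions on `ℝᴺ × (0, ∞)`: the equation is tested
against every smooth `φ` with compact support in `ℝᴺ × (0, ∞)`. Here `fderiv ℝ φ (x, t) (0, 1)`
is `∂ₜ φ (x, t)` and `fderiv ℝ φ (x, t) (f t x, 0)` is `f (x, t) · ∇ₓ φ (x, t)`. -/
def IsDistribEnergyBalance {N : ℕ}
    (e : ℝ → EuclideanSpace ℝ (Fin N) → ℝ)
    (f : ℝ → EuclideanSpace ℝ (Fin N) → EuclideanSpace ℝ (Fin N))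
    (d : ℝ → EuclideanSpace ℝ (Fin N) → ℝ) : Prop :=
  ∀ φ : EuclideanSpace ℝ (Fin N) × ℝ → ℝ,
    ContDiff ℝ ∞ φ → HasCompactSupport φ → tsupport φ ⊆ Set.univ ×ˢ Set.Ioi 0 →
      -(∫ t in Set.Ioi (0 : ℝ), ∫ x, e t x * fderiv ℝ φ (x, t) (0, 1)) =
        -(∫ t in Set.Ioi (0 : ℝ), ∫ x, fderiv ℝ φ (x, t) (f t x, 0))
          - ∫ t in Set.Ioi (0 : ℝ), ∫ x, d t x * φ (x, t)

/-- An extended dissipative system on `ℝᴺ` with phase space `X`: a continuous semiflow `Φ`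
(a `Flow` of the additive monoid `ℝ≥0`, jointly continuous in time and state) together with an
energy density `e`, a (backward) energy flux `f` and an energy dissipation rate `d` attached to
each state. The spaces `C(·, ·)` carry the compact-open topology, i.e. uniform convergence on
compact sets. -/
structure ExtendedDissipativeSystem (N : ℕ) (X : Type*) [TopologicalSpace X]
    [TopologicalSpace.MetrizableSpace X] where
  /-- the semiflow -/
  Φ : Flow ℝ≥0 X
  /-- the energy density -/
  e : X → C(EuclideanSpace ℝ (Fin N), ℝ≥0)
  /-- the energy flux (with the sign convention `∂ₜ e = div f - d`) -/
  f : X → C(EuclideanSpace ℝ (Fin N), EuclideanSpace ℝ (Fin N))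
  /-- the energy dissipation rate -/
  d : X → C(EuclideanSpace ℝ (Fin N), ℝ≥0)
  /-- the function bounding the flux in terms of the dissipation -/
  b : ℝ≥0 → ℝ≥0
  continuous_e : Continuous e
  continuous_f : Continuous f
  continuous_d : Continuous d
  monotone_b : Monotone b
  norm_flux_sq_le : ∀ u x, ‖f u x‖ ^ 2 ≤ b (e u x) * d u x
  equilibrium_of_dissipation_eq_zero : ∀ u, (∀ x, d u x = 0) → ∀ t, Φ t u = u
  energy_balance : ∀ u₀,
    IsDistribEnergyBalance (fun t x => (e (Φ t.toNNReal u₀) x : ℝ))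
      (fun t x => f (Φ t.toNNReal u₀) x) (fun t x => (d (Φ t.toNNReal u₀) x : ℝ))

/-- The energy dissipated along the trajectory of `u₀` in the ball `{|x| < R}` during `[0, T]`. -/
noncomputable def ExtendedDissipativeSystem.dissipatedEnergy {N : ℕ} {X : Type*}
    [TopologicalSpace X] [TopologicalSpace.MetrizableSpace X]
    (S : ExtendedDissipativeSystem N X) (u₀ : X) (R T : ℝ) : ℝ :=
  ∫ t in (0 : ℝ)..T, ∫ x in Metric.ball (0 : EuclideanSpace ℝ (Fin N)) R,
    (S.d (S.Φ t.toNNReal u₀) x : ℝ)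

open MeasureTheory Set Filter Topology

/-! The engine is a localized energy estimate. Testing the balance against `η²`, with `η` a cutoff
equal to `1` on `B_{R₁}`, produces the flux term `2η f·∇η`. Since `|f|² ≤ βd`, Young's inequality
gives `2η f·∇η + dη² + β|∇η|² ≥ 0`, so outside `B_{R₁}` the flux is absorbed by the dissipation at
the price `β|∇η|²`. As `e ≥ 0`, the dissipation in `B_{R₁}` up to time `T` is at most `∫ e(x,0) η² +
βT ∫ |∇η|²` (`dissipatedEnergy_le_of_cutoff`).

In the plane, logarithmic cutoffs bring `∫ |∇η|²` arbitrarily close to the capacity `2π / log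
(R₂/R₁)` (`exists_smooth_log_cutoff`), whence the bound `πe₀R₂² + 2πβT / log (R₂/R₁)`
(`dissipatedEnergy_le_log`). With `R₂ = √T/ℓ(T)` and `ℓ → ∞`, the first term is negligible against
`T/ℓ`; if `log (R₂/R(T)) ~ κℓ(T)`, the second is equivalent to `(2πβ/κ) T/ℓ`. The two claims are `ℓ
= log`, `κ = 1/2 - γ` and `ℓ = log log`, `κ = 1`.

The balance holds only as a distribution; `integrated_energy_balance` integrates it in time by a du
Bois-Reymond argument. -/

/-! ### Distributional differential equations on the half-line -/

/-- A primitive of a smooth function is smooth. -/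
theorem ContDiff.intervalIntegral_primitive {h : ℝ → ℝ} (hh : ContDiff ℝ ∞ h) (a : ℝ) :
    ContDiff ℝ ∞ (fun t => ∫ s in a..t, h s) := by
  have hd : ∀ t, HasDerivAt (fun t => ∫ s in a..t, h s) (h t) t := fun t =>
    hh.continuous.integral_hasStrictDerivAt a t |>.hasDerivAt
  rw [contDiff_infty_iff_deriv]
  refine ⟨fun t => (hd t).differentiableAt, ?_⟩
  rwa [show deriv (fun t => ∫ s in a..t, h s) = h from funext fun t => (hd t).deriv]

/-- A test function on `(0, ∞)` with zero mean has a primitive which is a test function. -/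
theorem exists_testFunction_primitive {h : ℝ → ℝ} (hh : ContDiff ℝ ∞ h) (hc : HasCompactSupport h)
    (hs : tsupport h ⊆ Ioi 0) (h0 : ∫ t, h t = 0) :
    ∃ χ : ℝ → ℝ, ContDiff ℝ ∞ χ ∧ HasCompactSupport χ ∧ tsupport χ ⊆ Ioi 0 ∧
      ∀ t, HasDerivAt χ (h t) t := by
  rcases (tsupport h).eq_empty_or_nonempty with he | hne
  · rw [tsupport_eq_empty_iff] at he
    refine ⟨0, contDiff_const, HasCompactSupport.zero, by simp, fun t => ?_⟩
    rw [he]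
    exact hasDerivAt_const t 0
  obtain ⟨a₀, ha₀⟩ := hc.isCompact.exists_isLeast hne
  obtain ⟨b, hb⟩ := hc.isCompact.exists_isGreatest hne
  have ha₀pos : 0 < a₀ := hs ha₀.1
  -- Starting strictly to the left of `a₀` puts the support of `h` inside the half-open `Ioc a t`
  -- with no endpoint discussion, and `a` is still positive.
  set a := a₀ / 2 with ha
  have hz : ∀ t, t ∉ Icc a₀ b → h t = 0 := fun t ht => by
    by_contra hne'
    have : t ∈ tsupport h := subset_tsupport h hne'
    exact ht ⟨ha₀.2 this, hb.2 this⟩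
  have hsupp : Function.support (fun t => ∫ s in a..t, h s) ⊆ Icc a b := by
    intro t ht
    by_contra hcon
    apply ht
    rcases lt_or_ge t a with hta | hta
    · refine intervalIntegral.integral_zero_ae (ae_of_all _ fun s hs' => hz s fun hs'' => ?_)
      rw [uIoc_of_ge hta.le] at hs'
      linarith [hs'.2, hs''.1]
    · have htb : b < t := by
        by_contra hbt
        exact hcon ⟨hta, not_lt.mp hbt⟩
      have : Function.support h ⊆ Ioc a t := by
        intro s hs'
        have := not_imp_comm.mp (hz s) hs'
        exact ⟨by linarith [this.1], by linarith [this.2]⟩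
      simp only [intervalIntegral.integral_eq_integral_of_support_subset this, h0]
  have hts : tsupport (fun t => ∫ s in a..t, h s) ⊆ Icc a b := closure_minimal hsupp isClosed_Icc
  refine ⟨fun t => ∫ s in a..t, h s, hh.intervalIntegral_primitive a,
    HasCompactSupport.of_support_subset_isCompact isCompact_Icc hsupp,
    hts.trans fun t ht => ?_, fun t => hh.continuous.integral_hasStrictDerivAt a t |>.hasDerivAt⟩
  exact lt_of_lt_of_le (by positivity) ht.1

/-- A continuous function whose distributional derivative vanishes on `(0, ∞)` is constant on
`[0, ∞)`. -/
theorem eq_of_forall_integral_mul_deriv_eq_zero {G : ℝ → ℝ} (hG : Continuous G)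
    (h : ∀ χ : ℝ → ℝ, ContDiff ℝ ∞ χ → HasCompactSupport χ → tsupport χ ⊆ Ioi 0 →
      ∫ t, G t * deriv χ t = 0) {T : ℝ} (hT : 0 ≤ T) : G T = G 0 := by
  -- A bump of unit mass supported in `[1, 3]`, hence away from `0`. Subtracting `m * ψ` from a test
  -- function of mass `m` makes it the derivative of a test function.
  let B : ContDiffBump (2 : ℝ) := ⟨1 / 2, 1, by norm_num, by norm_num⟩
  set ψ : ℝ → ℝ := B.normed volume with hψ
  have hψs : ContDiff ℝ ∞ ψ := B.contDiff_normed
  have hψc : HasCompactSupport ψ := B.hasCompactSupport_normed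
  have hψ1 : ∫ t, ψ t = 1 := B.integral_normed
  have hψt : tsupport ψ ⊆ Ioi 0 := by
    rw [hψ, B.tsupport_normed_eq, Real.closedBall_eq_Icc]
    intro t ht
    have := ht.1
    norm_num [B] at this
    exact lt_of_lt_of_le one_pos this
  set c := ∫ t, G t * ψ t with hc
  have hae : ∀ᵐ t : ℝ, t ∈ Ioi (0 : ℝ) → G t - c = 0 := by
    refine isOpen_Ioi.ae_eq_zero_of_integral_contDiff_smul_eq_zero
      ((hG.sub continuous_const).locallyIntegrable.locallyIntegrableOn _) fun g hg hgc hgt => ?_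
    have hgi : Integrable g := hg.continuous.integrable_of_hasCompactSupport hgc
    have hψi : Integrable ψ := hψs.continuous.integrable_of_hasCompactSupport hψc
    have hGg : Integrable fun t => G t * g t :=
      (hG.mul hg.continuous).integrable_of_hasCompactSupport hgc.mul_left
    have hGψ : Integrable fun t => G t * ψ t :=
      (hG.mul hψs.continuous).integrable_of_hasCompactSupport hψc.mul_left
    set m := ∫ t, g t with hm
    obtain ⟨χ, h1, h2, h3, h4⟩ := exists_testFunction_primitive (h := fun t => g t - m * ψ t)
      (hg.sub (contDiff_const.mul hψs)) (hgc.sub hψc.mul_left)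
      ((tsupport_sub _ _).trans (union_subset hgt
        ((tsupport_mul_subset_right (f := fun _ => m)).trans hψt)))
      (by rw [integral_sub hgi (hψi.const_mul m), integral_const_mul, hψ1]; simp [hm])
    have h5 := h χ h1 h2 h3
    simp only [(h4 _).deriv] at h5
    have h6 : ∫ t, G t * (g t - m * ψ t) = (∫ t, G t * g t) - m * c := by
      rw [hc, ← integral_const_mul, ← integral_sub hGg (hGψ.const_mul m)]
      congr 1; ext t; ring
    have h7 : ∫ t, g t • (G t - c) = (∫ t, G t * g t) - m * c := by
      rw [hm, ← integral_mul_const, ← integral_sub hGg (hgi.mul_const c)]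
      congr 1; ext t; simp only [smul_eq_mul]; ring
    rw [h7, ← h6, h5]
  -- Continuity upgrades almost everywhere to everywhere and includes the endpoint `0`.
  have hset : EqOn G (fun _ => c) (Ici 0) := by
    refine Measure.eqOn_of_ae_eq (μ := volume) ?_ hG.continuousOn continuousOn_const (by simp)
    rw [EventuallyEq, ae_restrict_iff' measurableSet_Ici]
    filter_upwards [hae, compl_mem_ae_iff.mpr (measure_singleton (0 : ℝ))] with t ht ht0 htI
    exact sub_eq_zero.mp (ht (lt_of_le_of_ne htI (Ne.symm ht0)))
  rw [hset (show T ∈ Ici 0 from hT), hset (show (0 : ℝ) ∈ Ici 0 from self_mem_Ici)]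

/-- The distributional equation `E' = -K` on `(0, ∞)`, with `E` and `K` continuous, in
integrated form. -/
theorem add_integral_eq_of_distrib {E K : ℝ → ℝ} (hE : Continuous E) (hK : Continuous K)
    (h : ∀ χ : ℝ → ℝ, ContDiff ℝ ∞ χ → HasCompactSupport χ → tsupport χ ⊆ Ioi 0 →
      ∫ t in Ioi (0 : ℝ), E t * deriv χ t = ∫ t in Ioi (0 : ℝ), K t * χ t)
    {T : ℝ} (hT : 0 ≤ T) : E T + ∫ t in (0 : ℝ)..T, K t = E 0 := by
  have hd : ∀ t, HasDerivAt (fun t => ∫ s in (0 : ℝ)..t, K s) (K t) t := fun t =>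
    hK.integral_hasStrictDerivAt 0 t |>.hasDerivAt
  have hP : Continuous fun t => ∫ s in (0 : ℝ)..t, K s :=
    continuous_iff_continuousAt.mpr fun t => (hd t).continuousAt
  have key := eq_of_forall_integral_mul_deriv_eq_zero
    (G := fun t => E t + ∫ s in (0 : ℝ)..t, K s) (hE.add hP) ?_ hT
  · simpa using key
  intro χ h1 h2 h3
  have hχ' : Continuous (deriv χ) := h1.continuous_deriv (by simp)
  have hi1 : Integrable fun t => E t * deriv χ t :=
    (hE.mul hχ').integrable_of_hasCompactSupport h2.deriv.mul_left
  have hi2 : Integrable fun t => (∫ s in (0 : ℝ)..t, K s) * deriv χ t :=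
    (hP.mul hχ').integrable_of_hasCompactSupport h2.deriv.mul_left
  have hχ0 : ∀ t ∉ Ioi (0 : ℝ), χ t = 0 := fun t ht => image_eq_zero_of_notMem_tsupport
    fun h' => ht (h3 h')
  have hχ0' : ∀ t ∉ Ioi (0 : ℝ), deriv χ t = 0 := fun t ht => image_eq_zero_of_notMem_tsupport
    fun h' => ht (h3 (tsupport_deriv_subset h'))
  have e1 := h χ h1 h2 h3
  rw [setIntegral_eq_integral_of_forall_compl_eq_zero (fun t ht => by rw [hχ0' t ht, mul_zero]),
    setIntegral_eq_integral_of_forall_compl_eq_zero (fun t ht => by rw [hχ0 t ht, mul_zero])] at e1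
  have e2 := integral_mul_deriv_eq_deriv_mul_of_integrable (fun t _ => hd t)
    (fun t _ => ((h1.differentiable (by simp)) t).hasDerivAt) hi2
    ((hK.mul h1.continuous).integrable_of_hasCompactSupport h2.mul_left)
    ((hP.mul h1.continuous).integrable_of_hasCompactSupport h2.mul_left)
  simp only [add_mul]
  rw [integral_add hi1 hi2, e1, e2]
  ring

/-! ### Logarithmic cutoffs in the plane -/

/-- A smooth step from `1` to `0` on `[a, b]` whose slope is nearly optimal. -/
theorem exists_smooth_step {a b M : ℝ} (hab : a < b) (hM : 1 < M) :
    ∃ H : ℝ → ℝ, ContDiff ℝ ∞ H ∧ (∀ s ≤ a, H s = 1) ∧ (∀ s, b ≤ s → H s = 0) ∧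
      (∀ s, H s ∈ Icc (0 : ℝ) 1) ∧ ∀ s, |deriv H s| ≤ M / (b - a) := by
  have hba : 0 < b - a := sub_pos.mpr hab
  have hM0 : 0 < M := one_pos.trans hM
  -- The plateau `B = 1` has length `(b - a) / M`, so the mass `m` is at least that; normalizing `B
  -- ≤ 1` by `m` then bounds the slope by `M / (b - a)`.
  let B : ContDiffBump ((a + b) / 2) := ⟨(b - a) / (2 * M), (b - a) / 2, by positivity, by
    rw [div_lt_div_iff₀ (by positivity) two_pos]; nlinarith⟩
  have hsupp : ∀ s, s ∉ Ioo a b → B s = 0 := fun s hs => by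
    refine B.zero_of_le_dist (not_lt.mp fun h => hs ?_)
    rw [Real.dist_eq, abs_lt] at h
    simp only [B] at h
    constructor <;> linarith [h.1, h.2]
  have hBc : Continuous B := B.continuous
  have hBi : ∀ x y, IntervalIntegrable B volume x y := fun x y => hBc.intervalIntegrable x y
  set m := ∫ s in a..b, B s with hm
  have hmlow : (b - a) / M ≤ m := by
    have h1 : ∫ s in ((a + b) / 2 - (b - a) / (2 * M))..((a + b) / 2 + (b - a) / (2 * M)), B s
        = (b - a) / M := by
      rw [intervalIntegral.integral_congr (g := fun _ => (1 : ℝ))]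
      · simp; field_simp; ring
      · intro s hs
        rw [uIcc_of_le (by linarith [show 0 < (b - a) / (2 * M) by positivity])] at hs
        refine B.one_of_mem_closedBall ?_
        rw [Real.closedBall_eq_Icc]
        exact hs
    have hlt : (b - a) / (2 * M) < (b - a) / 2 := B.rIn_lt_rOut
    have hpos : 0 < (b - a) / (2 * M) := by positivity
    rw [← h1, hm]
    exact intervalIntegral.integral_mono_interval (by linarith) (by linarith) (by linarith)
      (ae_of_all _ fun s => B.nonneg) (hBi _ _)
  have hmpos : 0 < m := lt_of_lt_of_le (by positivity) hmlow
  have hd : ∀ s, HasDerivAt (fun s => 1 - (∫ r in a..s, B r) / m) (-(B s / m)) s := fun s => by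
    simpa using ((hBc.integral_hasStrictDerivAt a s).hasDerivAt.div_const m).const_sub 1
  have h1 : ∀ s ≤ a, 1 - (∫ r in a..s, B r) / m = 1 := fun s hs => by
    rw [intervalIntegral.integral_zero_ae (ae_of_all _ fun r hr => hsupp r fun hr' => ?_)]
    · simp
    · rw [uIoc_of_ge hs] at hr
      linarith [hr.2, hr'.1]
  have h0 : ∀ s, b ≤ s → 1 - (∫ r in a..s, B r) / m = 0 := fun s hs => by
    rw [← intervalIntegral.integral_add_adjacent_intervals (hBi a b) (hBi b s),
      intervalIntegral.integral_zero_ae (a := b) (b := s)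
        (ae_of_all _ fun r hr => hsupp r fun hr' => ?_), add_zero, ← hm, div_self hmpos.ne',
        sub_self]
    rw [uIoc_of_le hs] at hr
    linarith [hr.1, hr'.2]
  have hanti : Antitone fun s => 1 - (∫ r in a..s, B r) / m :=
    antitone_of_hasDerivAt_nonpos hd fun s => neg_nonpos.mpr (div_nonneg B.nonneg hmpos.le)
  refine ⟨fun s => 1 - (∫ r in a..s, B r) / m,
    contDiff_const.sub ((B.contDiff.intervalIntegral_primitive a).div_const m), h1, h0,
    fun s => ⟨?_, ?_⟩, fun s => ?_⟩
  · rw [← h0 (max s b) (le_max_right _ _)]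
    exact hanti (le_max_left _ _)
  · exact (hanti (min_le_left s a)).trans_eq (h1 _ (min_le_right _ _))
  · rw [(hd s).deriv, abs_neg, abs_of_nonneg (div_nonneg B.nonneg hmpos.le)]
    calc B s / m ≤ 1 / m := by gcongr; exact B.le_one
      _ ≤ 1 / ((b - a) / M) := by gcongr
      _ = M / (b - a) := one_div_div _ _

/-- The integral of `|x|⁻²` over an annulus in the plane. -/
theorem integral_annulus_norm_sq_inv {R₁ R₂ : ℝ} (h₁ : 0 < R₁) (h₂ : R₁ ≤ R₂) (c : ℝ) :
    Integrable (fun x : EuclideanSpace ℝ (Fin 2) =>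
      (Ioc R₁ R₂).indicator (fun r => c * (r ^ 2)⁻¹) ‖x‖) ∧
    ∫ x : EuclideanSpace ℝ (Fin 2), (Ioc R₁ R₂).indicator (fun r => c * (r ^ 2)⁻¹) ‖x‖ =
      c * (2 * Real.pi * Real.log (R₂ / R₁)) := by
  -- The polar Jacobian `r` turns `r⁻²` into `r⁻¹`, the source of the logarithm.
  have hpt : ∀ y ∈ Ioi (0 : ℝ), y ^ (Module.finrank ℝ (EuclideanSpace ℝ (Fin 2)) - 1) •
      (Ioc R₁ R₂).indicator (fun r => c * (r ^ 2)⁻¹) y =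
      (Ioc R₁ R₂).indicator (fun r => c * r⁻¹) y := by
    intro y hy
    have hy0 : y ≠ 0 := (mem_Ioi.mp hy).ne'
    by_cases hy' : y ∈ Ioc R₁ R₂
    · simp [hy']; field_simp
    · simp [hy']
  have hsub : Ioc R₁ R₂ ⊆ Ioi 0 := fun y hy => h₁.trans hy.1
  have hnot : (0 : ℝ) ∉ uIcc R₁ R₂ := by
    rw [uIcc_of_le h₂]; exact fun h => absurd h.1 (not_le.mpr h₁)
  have hint : IntervalIntegrable (fun r : ℝ => c * r⁻¹) volume R₁ R₂ :=
    (intervalIntegral.intervalIntegrable_inv (fun y hy h => hnot (h ▸ hy))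
      continuousOn_id).const_mul c
  constructor
  · rw [integrable_fun_norm_addHaar, integrableOn_congr_fun hpt measurableSet_Ioi]
    rw [intervalIntegrable_iff_integrableOn_Ioc_of_le h₂] at hint
    exact ((integrable_indicator_iff measurableSet_Ioc).mpr hint).integrableOn
  · rw [integral_fun_norm_addHaar, setIntegral_congr_fun measurableSet_Ioi hpt,
      setIntegral_indicator measurableSet_Ioc, inter_eq_self_of_subset_right hsub,
      ← intervalIntegral.integral_of_le h₂, intervalIntegral.integral_const_mul,
      integral_inv hnot]
    simp [Measure.real, EuclideanSpace.volume_ball_fin_two, Real.pi_pos.le]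
    ring

/-- Smooth cutoffs between two discs of the plane whose Dirichlet energy is nearly the
capacity `2π / log (R₂ / R₁)`. -/
theorem exists_smooth_log_cutoff {R₁ R₂ M : ℝ} (h₁ : 0 < R₁) (h₂ : R₁ < R₂) (hM : 1 < M) :
    ∃ η : EuclideanSpace ℝ (Fin 2) → ℝ, ContDiff ℝ ∞ η ∧ HasCompactSupport η ∧
      (∀ x ∈ Metric.ball 0 R₁, η x = 1) ∧ (∀ x ∉ Metric.ball 0 R₂, η x = 0) ∧
      (∀ x, η x ∈ Icc (0 : ℝ) 1) ∧
      ∫ x, ‖fderiv ℝ η x‖ ^ 2 ≤ 2 * Real.pi * M ^ 2 / Real.log (R₂ / R₁) := by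
  have hR₂ : 0 < R₂ := h₁.trans h₂
  set ℓ := Real.log (R₂ / R₁) with hℓ
  have hℓ' : ℓ = Real.log R₂ - Real.log R₁ := Real.log_div hR₂.ne' h₁.ne'
  have hℓpos : 0 < ℓ := Real.log_pos ((one_lt_div h₁).mpr h₂)
  obtain ⟨H, hH, hH1, hH0, hH01, hH'⟩ := exists_smooth_step (Real.log_lt_log h₁ h₂) hM
  rw [← hℓ'] at hH'
  -- The origin is set apart because `Real.log 0 = 0`, and `H 0` need not be `1`.
  set η : EuclideanSpace ℝ (Fin 2) → ℝ :=
    fun x => if x = 0 then 1 else H (Real.log ‖x‖) with hη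
  have hη1 : ∀ x ∈ Metric.ball 0 R₁, η x = 1 := fun x hx => by
    by_cases hx0 : x = 0
    · simp [hη, hx0]
    · have : ‖x‖ < R₁ := by simpa using hx
      simp only [hη, hx0, if_false]
      exact hH1 _ (Real.log_le_log (norm_pos_iff.mpr hx0) this.le)
  have hη0 : ∀ x ∉ Metric.ball 0 R₂, η x = 0 := fun x hx => by
    have hx' : R₂ ≤ ‖x‖ := by simpa using hx
    have hx0 : x ≠ 0 := norm_pos_iff.mp (hR₂.trans_le hx')
    simp only [hη, hx0, if_false]
    exact hH0 _ (Real.log_le_log hR₂ hx')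
  have hηe : ∀ x ≠ 0, η =ᶠ[𝓝 x] fun y => H (Real.log ‖y‖) := fun x hx => by
    filter_upwards [isOpen_ne.mem_nhds hx] with y hy
    simp only [hη, if_neg (show y ≠ 0 from hy)]
  have hηs : ContDiff ℝ ∞ η := by
    rw [contDiff_iff_contDiffAt]
    intro x
    by_cases hx : x = 0
    · refine (contDiffAt_const (c := (1 : ℝ))).congr_of_eventuallyEq ?_
      filter_upwards [Metric.isOpen_ball.mem_nhds (show x ∈ Metric.ball 0 R₁ by simpa [hx])]
        with y hy using hη1 y hy
    · refine ContDiffAt.congr_of_eventuallyEq ?_ (hηe x hx)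
      exact hH.contDiffAt.comp x ((contDiffAt_norm ℝ hx).log (norm_ne_zero_iff.mpr hx))
  have hηc : HasCompactSupport η :=
    HasCompactSupport.of_support_subset_isCompact (isCompact_closedBall (0 : _) R₂) fun x hx =>
      Metric.ball_subset_closedBall (not_imp_comm.mp (hη0 x) hx)
  refine ⟨η, hηs, hηc, hη1, hη0, fun x => ?_, ?_⟩
  · by_cases hx : x = 0
    · simp [hη, hx]
    · simpa only [hη, hx, if_false] using hH01 _
  have hnorm : ∀ x ≠ 0, ‖fderiv ℝ η x‖ ≤ M / ℓ * ‖x‖⁻¹ := fun x hx => by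
    have hx' : ‖x‖ ≠ 0 := norm_ne_zero_iff.mpr hx
    rw [(hηe x hx).fderiv_eq]
    have hn : HasFDerivAt (fun y : EuclideanSpace ℝ (Fin 2) => ‖y‖) (fderiv ℝ norm x) x :=
      ((contDiffAt_norm ℝ hx (n := 1)).differentiableAt (by simp)).hasFDerivAt
    have hl := (Real.hasDerivAt_log hx').comp_hasFDerivAt x hn
    have hc := ((hH.differentiable (by simp)) (Real.log ‖x‖)).hasDerivAt.comp_hasFDerivAt x hl
    have hc' : fderiv ℝ (fun y => H (Real.log ‖y‖)) x = _ := hc.fderiv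
    rw [hc', norm_smul, norm_smul, norm_inv, norm_norm, Real.norm_eq_abs]
    have hle : ‖fderiv ℝ (norm : EuclideanSpace ℝ (Fin 2) → ℝ) x‖ ≤ 1 := by
      simpa using norm_fderiv_le_of_lipschitz ℝ (x₀ := x) (lipschitzWith_one_norm)
    calc _ ≤ M / ℓ * (‖x‖⁻¹ * 1) := by gcongr; exact hH' _
      _ = _ := by rw [mul_one]
  have hz1 : ∀ x ∈ Metric.ball 0 R₁, fderiv ℝ η x = 0 := fun x hx => by
    rw [Filter.EventuallyEq.fderiv_eq (f := fun _ => (1 : ℝ))]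
    · simp
    · filter_upwards [Metric.isOpen_ball.mem_nhds hx] with y hy using hη1 y hy
  have hz2 : ∀ x ∉ Metric.closedBall 0 R₂, fderiv ℝ η x = 0 := fun x hx => by
    rw [Filter.EventuallyEq.fderiv_eq (f := fun _ => (0 : ℝ))]
    · simp
    · filter_upwards [Metric.isClosed_closedBall.isOpen_compl.mem_nhds hx] with y hy using
        hη0 y fun h => hy (Metric.ball_subset_closedBall h)
  obtain ⟨hi, hv⟩ := integral_annulus_norm_sq_inv h₁ h₂.le ((M / ℓ) ^ 2)
  -- `Ioc R₁ R₂` omits the inner circle, which is covered neither by the open ball nor by the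
  -- annulus; it is a null set.
  have hae : ∀ᵐ x : EuclideanSpace ℝ (Fin 2), x ∉ Metric.sphere 0 R₁ :=
    compl_mem_ae_iff.mpr (Measure.addHaar_sphere _ _ _)
  calc ∫ x, ‖fderiv ℝ η x‖ ^ 2
      ≤ ∫ x : EuclideanSpace ℝ (Fin 2),
          (Ioc R₁ R₂).indicator (fun r => (M / ℓ) ^ 2 * (r ^ 2)⁻¹) ‖x‖ := by
        refine integral_mono_of_nonneg (ae_of_all _ fun x => by positivity) hi ?_
        filter_upwards [hae] with x hxs
        by_cases hx : ‖x‖ ∈ Ioc R₁ R₂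
        · rw [indicator_of_mem hx, ← inv_pow, ← mul_pow]
          have := hnorm x (norm_pos_iff.mp (h₁.trans hx.1))
          gcongr
        · rw [indicator_of_notMem hx]
          have : fderiv ℝ η x = 0 := by
            by_cases hx1 : x ∈ Metric.ball 0 R₁
            · exact hz1 x hx1
            · refine hz2 x fun hx2 => hx ⟨?_, by simpa using hx2⟩
              rw [mem_ball_zero_iff, not_lt] at hx1
              exact lt_of_le_of_ne hx1 fun h => hxs (by simp [h])
          simp [this]
    _ = 2 * Real.pi * M ^ 2 / ℓ := by rw [hv, ← hℓ]; field_simp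

/-! ### Product test functions and Young's inequality -/

/-- Taken at `(0, 1)` and at `(f, 0)`, this separates space from time in the two derivative terms of
the weak balance. -/
theorem fderiv_mul_prod_apply {V : Type*} [NormedAddCommGroup V] [NormedSpace ℝ V] {φ : V → ℝ}
    {χ : ℝ → ℝ} (hφ : ContDiff ℝ ∞ φ) (hχ : ContDiff ℝ ∞ χ) (x v : V) (t s : ℝ) :
    fderiv ℝ (fun p : V × ℝ => φ p.1 * χ p.2) (x, t) (v, s) =
      φ x * (s * deriv χ t) + χ t * fderiv ℝ φ x v := by
  have h1 : HasFDerivAt (fun p : V × ℝ => φ p.1) _ (x, t) :=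
    ((hφ.differentiable (by simp)) x).hasFDerivAt.comp (x, t) hasFDerivAt_fst
  have h2 : HasFDerivAt (fun p : V × ℝ => χ p.2) _ (x, t) :=
    ((hχ.differentiable (by simp)) t).hasDerivAt.hasFDerivAt.comp (x, t) hasFDerivAt_snd
  have h3 : fderiv ℝ (fun p : V × ℝ => φ p.1 * χ p.2) (x, t) = _ := (h1.mul h2).fderiv
  rw [h3]
  simp

theorem tsupport_mul_prod_subset {V : Type*} [TopologicalSpace V] {φ : V → ℝ} {χ : ℝ → ℝ} :
    tsupport (fun p : V × ℝ => φ p.1 * χ p.2) ⊆ tsupport φ ×ˢ tsupport χ := by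
  refine closure_minimal (fun p hp => ?_) ((isClosed_tsupport φ).prod (isClosed_tsupport χ))
  exact ⟨subset_tsupport _ (left_ne_zero_of_mul hp), subset_tsupport _ (right_ne_zero_of_mul hp)⟩

theorem continuous_integral_of_forall_notMem_eq_zero {N : ℕ} {g : ℝ → EuclideanSpace ℝ (Fin N) → ℝ}
    (hg : Continuous (Function.uncurry g)) {s : Set (EuclideanSpace ℝ (Fin N))} (hs : IsCompact s)
    (h0 : ∀ t, ∀ x ∉ s, g t x = 0) : Continuous fun t => ∫ x, g t x := by
  simpa only [setIntegral_eq_integral_of_forall_compl_eq_zero (h0 _)] using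
    continuous_parametric_integral_of_continuous (μ := volume) hg hs

/-- Young's inequality for a flux `v` with `|v|² ≤ β δ`. -/
theorem two_mul_apply_add_nonneg {V : Type*} [NormedAddCommGroup V] [NormedSpace ℝ V] {β δ : ℝ}
    (hβ : 0 ≤ β) (hδ : 0 ≤ δ) {v : V} (hv : ‖v‖ ^ 2 ≤ β * δ) (g : V →L[ℝ] ℝ) (a : ℝ) :
    0 ≤ 2 * a * g v + δ * a ^ 2 + β * ‖g‖ ^ 2 := by
  have hv' : ‖v‖ ≤ √β * √δ := by
    rw [← Real.sqrt_mul hβ]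
    exact Real.le_sqrt_of_sq_le hv
  have hop : |g v| ≤ ‖g‖ * (√β * √δ) := (g.le_opNorm v).trans (by gcongr)
  have hprod : |2 * a * g v| ≤ 2 * |a| * (‖g‖ * (√β * √δ)) := by
    rw [abs_mul, abs_mul, abs_two]
    gcongr
  have hsq : (|a| * √δ - √β * ‖g‖) ^ 2 =
      δ * a ^ 2 + β * ‖g‖ ^ 2 - 2 * |a| * (‖g‖ * (√β * √δ)) := by
    rw [sub_sq, mul_pow, mul_pow, Real.sq_sqrt hβ, Real.sq_sqrt hδ, sq_abs]
    ring
  linarith [sq_nonneg (|a| * √δ - √β * ‖g‖), neg_abs_le (2 * a * g v)]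

theorem integrable_norm_fderiv_sq {N : ℕ} {η : EuclideanSpace ℝ (Fin N) → ℝ}
    (hη : ContDiff ℝ ∞ η) (hc : HasCompactSupport η) :
    Integrable fun x => ‖fderiv ℝ η x‖ ^ 2 := by
  have hη' : Continuous (fderiv ℝ η) := hη.continuous_fderiv (by simp)
  have hcont : Continuous fun x => ‖fderiv ℝ η x‖ ^ 2 := by fun_prop
  refine hcont.integrable_of_hasCompactSupport ?_
  refine HasCompactSupport.of_support_subset_isCompact (hc.fderiv ℝ).isCompact fun x hx => ?_
  refine subset_tsupport _ fun h => hx ?_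
  simp [h]

/-! ### Localized energy estimates -/

namespace ExtendedDissipativeSystem

variable {N : ℕ} {X : Type*} [TopologicalSpace X] [TopologicalSpace.MetrizableSpace X]
  (S : ExtendedDissipativeSystem N X) (u₀ : X)

theorem continuous_trajectory : Continuous fun t : ℝ => S.Φ t.toNNReal u₀ :=
  S.Φ.continuous continuous_real_toNNReal continuous_const

theorem continuous_e_trajectory : Continuous fun p : ℝ × EuclideanSpace ℝ (Fin N) =>
    (S.e (S.Φ p.1.toNNReal u₀) p.2 : ℝ) :=
  NNReal.continuous_coe.comp
    ((S.continuous_e.comp ((S.continuous_trajectory u₀).comp continuous_fst)).eval continuous_snd)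

theorem continuous_d_trajectory : Continuous fun p : ℝ × EuclideanSpace ℝ (Fin N) =>
    (S.d (S.Φ p.1.toNNReal u₀) p.2 : ℝ) :=
  NNReal.continuous_coe.comp
    ((S.continuous_d.comp ((S.continuous_trajectory u₀).comp continuous_fst)).eval continuous_snd)

theorem continuous_f_trajectory : Continuous fun p : ℝ × EuclideanSpace ℝ (Fin N) =>
    S.f (S.Φ p.1.toNNReal u₀) p.2 :=
  (S.continuous_f.comp ((S.continuous_trajectory u₀).comp continuous_fst)).eval continuous_snd

theorem continuous_setIntegral_ball_d (R : ℝ) :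
    Continuous fun t : ℝ => ∫ x in Metric.ball (0 : EuclideanSpace ℝ (Fin N)) R,
      (S.d (S.Φ t.toNNReal u₀) x : ℝ) := by
  -- The continuity theorem wants a compact domain: integrate over the closed ball for the measure
  -- restricted to the open one.
  have := continuous_parametric_integral_of_continuous
    (μ := volume.restrict (Metric.ball (0 : EuclideanSpace ℝ (Fin N)) R))
    (f := fun (t : ℝ) x => (S.d (S.Φ t.toNNReal u₀) x : ℝ)) (S.continuous_d_trajectory u₀)
    (isCompact_closedBall 0 R)
  rwa [Measure.restrict_restrict Metric.isClosed_closedBall.measurableSet,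
    inter_eq_self_of_subset_right Metric.ball_subset_closedBall] at this

variable {φ : EuclideanSpace ℝ (Fin N) → ℝ}

theorem continuous_integral_flux_add_dissipation (hφ : ContDiff ℝ ∞ φ)
    (hc : HasCompactSupport φ) : Continuous fun t : ℝ =>
      ∫ x, (fderiv ℝ φ x (S.f (S.Φ t.toNNReal u₀) x) + S.d (S.Φ t.toNNReal u₀) x * φ x) := by
  have hφ' : Continuous (fderiv ℝ φ) := hφ.continuous_fderiv (by simp)
  refine continuous_integral_of_forall_notMem_eq_zero ?_ hc.isCompact fun t x hx => ?_
  · exact ((hφ'.comp continuous_snd).clm_apply (S.continuous_f_trajectory u₀)).add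
      ((S.continuous_d_trajectory u₀).mul (hφ.continuous.comp continuous_snd))
  · rw [image_eq_zero_of_notMem_tsupport hx, image_eq_zero_of_notMem_tsupport
      (f := fderiv ℝ φ) fun h => hx (tsupport_fderiv_subset ℝ h)]
    simp

theorem integrable_flux_mul (hφ : ContDiff ℝ ∞ φ) (hc : HasCompactSupport φ) (u : X) :
    Integrable fun x => fderiv ℝ φ x (S.f u x) := by
  refine ((hφ.continuous_fderiv (by simp)).clm_apply
    (S.f u).continuous).integrable_of_hasCompactSupport ?_
  refine HasCompactSupport.of_support_subset_isCompact (hc.fderiv ℝ).isCompact fun x hx => ?_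
  refine subset_tsupport _ fun h => hx ?_
  simp [h]

theorem integrable_dissipation_mul (hφ : ContDiff ℝ ∞ φ) (hc : HasCompactSupport φ) (u : X) :
    Integrable fun x => (S.d u x : ℝ) * φ x :=
  ((NNReal.continuous_coe.comp (S.d u).continuous).mul
    hφ.continuous).integrable_of_hasCompactSupport hc.mul_left

/-- The energy balance integrated in time and against a test function of the space variable. -/
theorem integrated_energy_balance (hφ : ContDiff ℝ ∞ φ) (hc : HasCompactSupport φ) {T : ℝ}
    (hT : 0 ≤ T) :
    (∫ x, (S.e (S.Φ T.toNNReal u₀) x : ℝ) * φ x) + ∫ t in (0 : ℝ)..T,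
      ∫ x, (fderiv ℝ φ x (S.f (S.Φ t.toNNReal u₀) x) + S.d (S.Φ t.toNNReal u₀) x * φ x) =
      ∫ x, (S.e u₀ x : ℝ) * φ x := by
  have hE : Continuous fun t : ℝ => ∫ x, (S.e (S.Φ t.toNNReal u₀) x : ℝ) * φ x := by
    refine continuous_integral_of_forall_notMem_eq_zero ?_ hc.isCompact fun t x hx => ?_
    · exact (S.continuous_e_trajectory u₀).mul (hφ.continuous.comp continuous_snd)
    · rw [image_eq_zero_of_notMem_tsupport hx, mul_zero]
  have key := add_integral_eq_of_distrib hE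
    (S.continuous_integral_flux_add_dissipation u₀ hφ hc) ?_ hT
  · simpa [S.Φ.map_zero_apply] using key
  intro χ h1 h2 h3
  have hb := S.energy_balance u₀ (fun p => φ p.1 * χ p.2)
    ((hφ.comp contDiff_fst).mul (h1.comp contDiff_snd))
    (HasCompactSupport.of_support_subset_isCompact (hc.isCompact.prod h2.isCompact)
      ((subset_tsupport _).trans tsupport_mul_prod_subset))
    (tsupport_mul_prod_subset.trans (prod_mono (subset_univ _) h3))
  simp only [fderiv_mul_prod_apply hφ h1, one_mul, map_zero, mul_zero, add_zero, zero_mul,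
    zero_add, ← mul_assoc, integral_mul_const, integral_const_mul] at hb
  have hφ' : Continuous (fderiv ℝ φ) := hφ.continuous_fderiv (by simp)
  have hF : Continuous fun t : ℝ => ∫ x, fderiv ℝ φ x (S.f (S.Φ t.toNNReal u₀) x) := by
    refine continuous_integral_of_forall_notMem_eq_zero ?_ hc.isCompact fun t x hx => ?_
    · exact (hφ'.comp continuous_snd).clm_apply (S.continuous_f_trajectory u₀)
    · rw [image_eq_zero_of_notMem_tsupport
        (f := fderiv ℝ φ) fun h => hx (tsupport_fderiv_subset ℝ h)]
      simp
  have hD : Continuous fun t : ℝ => ∫ x, (S.d (S.Φ t.toNNReal u₀) x : ℝ) * φ x := by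
    refine continuous_integral_of_forall_notMem_eq_zero ?_ hc.isCompact fun t x hx => ?_
    · exact (S.continuous_d_trajectory u₀).mul (hφ.continuous.comp continuous_snd)
    · rw [image_eq_zero_of_notMem_tsupport hx, mul_zero]
  have hiF : Integrable fun t => χ t * ∫ x, fderiv ℝ φ x (S.f (S.Φ t.toNNReal u₀) x) :=
    (h1.continuous.mul hF).integrable_of_hasCompactSupport h2.mul_right
  have hiD : Integrable fun t => (∫ x, (S.d (S.Φ t.toNNReal u₀) x : ℝ) * φ x) * χ t :=
    (hD.mul h1.continuous).integrable_of_hasCompactSupport h2.mul_left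
  calc _ = (∫ t in Ioi (0 : ℝ), χ t * ∫ x, fderiv ℝ φ x (S.f (S.Φ t.toNNReal u₀) x)) +
        ∫ t in Ioi (0 : ℝ), (∫ x, (S.d (S.Φ t.toNNReal u₀) x : ℝ) * φ x) * χ t := by linarith
    _ = _ := by
      rw [← integral_add hiF.integrableOn hiD.integrableOn]
      refine integral_congr_ae (ae_of_all _ fun t => ?_)
      simp only
      rw [integral_add (S.integrable_flux_mul hφ hc _) (S.integrable_dissipation_mul hφ hc _)]
      ring

variable {η : EuclideanSpace ℝ (Fin N) → ℝ}

/-- Where the cutoff `η` equals `1` the dissipation is seen in full, elsewhere the flux of `η²` is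
absorbed up to the Dirichlet energy density of `η`. -/
theorem indicator_dissipation_le {β R : ℝ} (hβ0 : 0 ≤ β) {u : X}
    (hβ : ∀ x, (S.b (S.e u x) : ℝ) ≤ β) (hη : ContDiff ℝ ∞ η)
    (h1 : ∀ x ∈ Metric.ball 0 R, η x = 1) (x : EuclideanSpace ℝ (Fin N)) :
    (Metric.ball 0 R).indicator (fun x => (S.d u x : ℝ)) x ≤
      (fderiv ℝ (fun x => η x ^ 2) x (S.f u x) + S.d u x * η x ^ 2)
        + β * ‖fderiv ℝ η x‖ ^ 2 := by
  have hder : fderiv ℝ (fun x => η x ^ 2) x (S.f u x) = 2 * η x * fderiv ℝ η x (S.f u x) := by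
    rw [((hη.differentiable (by simp) x).hasFDerivAt.pow 2).fderiv]
    simp
  rw [hder]
  -- Inside the ball `∇η = 0` and both sides agree; outside, Young's inequality applies with `a = η
  -- x`.
  by_cases hx : x ∈ Metric.ball 0 R
  · have hz : fderiv ℝ η x = 0 := by
      rw [Filter.EventuallyEq.fderiv_eq (f := fun _ => (1 : ℝ))]
      · simp
      · filter_upwards [Metric.isOpen_ball.mem_nhds hx] with y hy using h1 y hy
    rw [indicator_of_mem hx, hz, h1 x hx]
    simp
  · rw [indicator_of_notMem hx]
    exact two_mul_apply_add_nonneg hβ0 (NNReal.coe_nonneg _) ((S.norm_flux_sq_le u x).trans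
      (mul_le_mul_of_nonneg_right (hβ x) (NNReal.coe_nonneg _))) _ _

theorem setIntegral_ball_dissipation_le {β R : ℝ} (hβ0 : 0 ≤ β) {u : X}
    (hβ : ∀ x, (S.b (S.e u x) : ℝ) ≤ β) (hη : ContDiff ℝ ∞ η) (hc : HasCompactSupport η)
    (h1 : ∀ x ∈ Metric.ball 0 R, η x = 1) :
    ∫ x in Metric.ball 0 R, (S.d u x : ℝ) ≤
      (∫ x, (fderiv ℝ (fun x => η x ^ 2) x (S.f u x) + S.d u x * η x ^ 2))
        + β * ∫ x, ‖fderiv ℝ η x‖ ^ 2 := by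
  have hφ : ContDiff ℝ ∞ fun x => η x ^ 2 := hη.pow 2
  have hφc : HasCompactSupport fun x => η x ^ 2 := hc.comp_left (g := fun y => y ^ 2) (by simp)
  have hgi : Integrable fun x => β * ‖fderiv ℝ η x‖ ^ 2 :=
    (integrable_norm_fderiv_sq hη hc).const_mul β
  have hi : Integrable fun x =>
      fderiv ℝ (fun x => η x ^ 2) x (S.f u x) + S.d u x * η x ^ 2 :=
    (S.integrable_flux_mul hφ hφc u).add (S.integrable_dissipation_mul hφ hφc u)
  rw [← integral_indicator Metric.isOpen_ball.measurableSet, ← integral_const_mul,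
    ← integral_add hi hgi]
  exact integral_mono_of_nonneg
    (ae_of_all _ fun x => indicator_nonneg (fun _ _ => NNReal.coe_nonneg _) _)
    (hi.add hgi) (ae_of_all _ (S.indicator_dissipation_le hβ0 hβ hη h1))

/-- The dissipation in a ball is controlled by the initial energy and by the Dirichlet energy of
any cutoff function. -/
theorem dissipatedEnergy_le_of_cutoff {β R T : ℝ} (hβ0 : 0 ≤ β) (hT : 0 ≤ T)
    (hβ : ∀ t x, (S.b (S.e (S.Φ t u₀) x) : ℝ) ≤ β)
    (hη : ContDiff ℝ ∞ η) (hc : HasCompactSupport η) (h1 : ∀ x ∈ Metric.ball 0 R, η x = 1) :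
    S.dissipatedEnergy u₀ R T ≤
      (∫ x, (S.e u₀ x : ℝ) * η x ^ 2) + T * (β * ∫ x, ‖fderiv ℝ η x‖ ^ 2) := by
  have hφ : ContDiff ℝ ∞ fun x => η x ^ 2 := hη.pow 2
  have hφc : HasCompactSupport fun x => η x ^ 2 := hc.comp_left (g := fun y => y ^ 2) (by simp)
  have hbal := S.integrated_energy_balance u₀ hφ hφc hT
  -- The energy remaining at time `T` has a favourable sign and is dropped.
  have hpos : 0 ≤ ∫ x, (S.e (S.Φ T.toNNReal u₀) x : ℝ) * η x ^ 2 :=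
    integral_nonneg fun x => mul_nonneg (NNReal.coe_nonneg _) (sq_nonneg _)
  have hK := S.continuous_integral_flux_add_dissipation u₀ hφ hφc
  have hmono := intervalIntegral.integral_mono_on hT
    ((S.continuous_setIntegral_ball_d u₀ R).intervalIntegrable (μ := volume) _ _)
    ((hK.add continuous_const).intervalIntegrable _ _)
    fun t _ => S.setIntegral_ball_dissipation_le hβ0 (hβ t.toNNReal) hη hc h1
  simp only [Pi.add_apply] at hmono
  rw [intervalIntegral.integral_add (hK.intervalIntegrable _ _) intervalIntegrable_const,
    intervalIntegral.integral_const, sub_zero, smul_eq_mul] at hmono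
  rw [dissipatedEnergy]
  linarith

/-! ### Capacity bound and growth rates -/

/-- In the plane, the dissipation in `B_{R₁}` is bounded in terms of the logarithmic capacity of
`B_{R₁}` relative to any larger disc. -/
theorem dissipatedEnergy_le_log (S : ExtendedDissipativeSystem 2 X) {e₀ β R₁ R₂ T : ℝ}
    (hβ0 : 0 ≤ β) (hT : 0 ≤ T) (he : ∀ x, (S.e u₀ x : ℝ) ≤ e₀)
    (hβ : ∀ t x, (S.b (S.e (S.Φ t u₀) x) : ℝ) ≤ β) (h₁ : 0 < R₁) (h₂ : R₁ < R₂) :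
    S.dissipatedEnergy u₀ R₁ T ≤
      Real.pi * e₀ * R₂ ^ 2 + 2 * Real.pi * β * T / Real.log (R₂ / R₁) := by
  have hR₂ : 0 < R₂ := h₁.trans h₂
  have hM : ∀ M : ℝ, 1 < M → S.dissipatedEnergy u₀ R₁ T ≤
      Real.pi * e₀ * R₂ ^ 2 + T * (β * (2 * Real.pi * M ^ 2 / Real.log (R₂ / R₁))) := by
    intro M hM
    obtain ⟨η, hη, hc, h1, h0, h01, hD⟩ := exists_smooth_log_cutoff h₁ h₂ hM
    refine (S.dissipatedEnergy_le_of_cutoff u₀ hβ0 hT hβ hη hc h1).trans (add_le_add ?_ ?_)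
    · have hvol : ∫ x : EuclideanSpace ℝ (Fin 2),
          (Metric.ball 0 R₂).indicator (fun _ => e₀) x = Real.pi * e₀ * R₂ ^ 2 := by
        rw [integral_indicator_const _ Metric.isOpen_ball.measurableSet]
        simp [Measure.real, EuclideanSpace.volume_ball_fin_two, Real.pi_pos.le, hR₂.le]
        ring
      rw [← hvol]
      refine integral_mono_of_nonneg (ae_of_all _ fun x => by positivity) ?_
        (ae_of_all _ fun x => ?_)
      · exact (integrable_indicator_iff Metric.isOpen_ball.measurableSet).mpr
          (integrableOn_const measure_ball_lt_top.ne)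
      · by_cases hx : x ∈ Metric.ball 0 R₂
        · simp only [indicator_of_mem hx]
          calc (S.e u₀ x : ℝ) * η x ^ 2 ≤ S.e u₀ x * 1 := by
                gcongr
                exact pow_le_one₀ (h01 x).1 (h01 x).2
            _ ≤ e₀ := by rw [mul_one]; exact he x
        · simp [indicator_of_notMem hx, h0 x hx]
    · gcongr
  -- The left side does not depend on `M`, so the loss in the smooth cutoff disappears as `M → 1⁺`.
  have hcont : Tendsto (fun M : ℝ => Real.pi * e₀ * R₂ ^ 2 +
      T * (β * (2 * Real.pi * M ^ 2 / Real.log (R₂ / R₁)))) (𝓝[>] 1)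
      (𝓝 (Real.pi * e₀ * R₂ ^ 2 + T * (β * (2 * Real.pi * 1 ^ 2 / Real.log (R₂ / R₁))))) :=
    Continuous.continuousWithinAt (by fun_prop)
  have := ge_of_tendsto hcont (by filter_upwards [self_mem_nhdsWithin] with M h using hM M h)
  refine this.trans_eq ?_
  ring

/-- The dissipation bound along radii `R(T)` that are smaller than `√T / ℓ(T)` by a factor
`exp (-κ ℓ(T))` up to lower order terms. -/
theorem limsup_dissipatedEnergy_le (S : ExtendedDissipativeSystem 2 X) {e₀ β κ : ℝ}
    (hβ0 : 0 ≤ β) (he : ∀ x, (S.e u₀ x : ℝ) ≤ e₀)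
    (hβ : ∀ t x, (S.b (S.e (S.Φ t u₀) x) : ℝ) ≤ β) {R ℓ : ℝ → ℝ} (hκ : 0 < κ)
    (hℓ : Tendsto ℓ atTop atTop) (hR : ∀ᶠ T in atTop, 0 < R T)
    (hlog : Tendsto (fun T => Real.log (√T / ℓ T / R T) / ℓ T) atTop (𝓝 κ)) :
    limsup (fun T : ℝ => ((ℓ T / T * S.dissipatedEnergy u₀ (R T) T : ℝ) : EReal)) atTop
      ≤ ((2 * Real.pi * β / κ : ℝ) : EReal) := by
  -- This majorant is the capacity bound with `R₂ = √T / ℓ T`, multiplied by `ℓ T / T`.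
  have hlim : Tendsto (fun T => Real.pi * e₀ * (ℓ T)⁻¹ +
      2 * Real.pi * β / (Real.log (√T / ℓ T / R T) / ℓ T)) atTop (𝓝 (2 * Real.pi * β / κ)) := by
    simpa using (hℓ.inv_tendsto_atTop.const_mul (Real.pi * e₀)).add
      ((tendsto_const_nhds (x := 2 * Real.pi * β)).div hlog hκ.ne')
  rw [← (EReal.tendsto_coe.mpr hlim).limsup_eq]
  refine limsup_le_limsup ?_
  filter_upwards [hR, hℓ.eventually_gt_atTop 0, hlog.eventually_const_lt hκ,
    eventually_gt_atTop 0] with T hRT hℓT hlogT hT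
  rw [EReal.coe_le_coe_iff]
  have hlp : 0 < Real.log (√T / ℓ T / R T) := (div_pos_iff_of_pos_right hℓT).mp hlogT
  have hlt : R T < √T / ℓ T := by
    rw [Real.log_pos_iff (by positivity), one_lt_div hRT] at hlp
    exact hlp
  calc ℓ T / T * S.dissipatedEnergy u₀ (R T) T
      ≤ ℓ T / T * (Real.pi * e₀ * (√T / ℓ T) ^ 2 +
          2 * Real.pi * β * T / Real.log (√T / ℓ T / R T)) := by
        gcongr
        exact S.dissipatedEnergy_le_log u₀ hβ0 hT.le he hβ hRT hlt
    _ = _ := by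
        rw [div_pow, Real.sq_sqrt hT.le]
        field_simp

end ExtendedDissipativeSystem

/-- If `log (√T / R(T)) = κ ℓ(T) - c`, then the logarithm of `√T / (ℓ(T) R(T))` is equivalent to
`κ ℓ(T)`. -/
theorem tendsto_log_div_of_eq {R ℓ : ℝ → ℝ} {κ c : ℝ} (hℓ : Tendsto ℓ atTop atTop)
    (hR : ∀ᶠ T in atTop, 0 < R T)
    (h : ∀ᶠ T in atTop, Real.log (√T / R T) = κ * ℓ T - c) :
    Tendsto (fun T => Real.log (√T / ℓ T / R T) / ℓ T) atTop (𝓝 κ) := by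
  have h1 : Tendsto (fun T => Real.log (ℓ T) / ℓ T) atTop (𝓝 0) :=
    (Real.isLittleO_log_id_atTop.tendsto_div_nhds_zero).comp hℓ
  have h2 : Tendsto (fun T => κ - c * (ℓ T)⁻¹ - Real.log (ℓ T) / ℓ T) atTop (𝓝 κ) := by
    simpa using ((hℓ.inv_tendsto_atTop.const_mul c).const_sub κ).sub h1
  refine h2.congr' ?_
  filter_upwards [h, hR, hℓ.eventually_gt_atTop 0, eventually_gt_atTop 0] with T hT hRT hℓT hT0
  rw [div_right_comm, Real.log_div (by positivity) hℓT.ne', hT]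
  field_simp

theorem corollary4p3 {X : Type*} [TopologicalSpace X] [TopologicalSpace.MetrizableSpace X]
    (S : ExtendedDissipativeSystem 2 X) (u₀ : X) (e₀ β : ℝ)
    (he₀_pos : 0 < e₀) (hβ_pos : 0 < β)
    (he₀ : IsLUB (Set.range fun x : EuclideanSpace ℝ (Fin 2) => (S.e u₀ x : ℝ)) e₀)
    (hβ : IsLUB (Set.range fun p : EuclideanSpace ℝ (Fin 2) × ℝ≥0 =>
      (S.b (S.e (S.Φ p.2 u₀) p.1) : ℝ)) β) :
    (∀ R₀ γ : ℝ, 0 < R₀ → 0 ≤ γ → γ < 1 / 2 →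
      Filter.limsup (fun T : ℝ =>
          ((Real.log T / T * S.dissipatedEnergy u₀ (R₀ * T ^ γ) T : ℝ) : EReal)) Filter.atTop
        ≤ ((4 * Real.pi * β / (1 - 2 * γ) : ℝ) : EReal)) ∧
    (∀ R₀ : ℝ, 0 < R₀ →
      Filter.limsup (fun T : ℝ =>
          ((Real.log (Real.log T) / T *
            S.dissipatedEnergy u₀ (R₀ * √T / Real.log T) T : ℝ) : EReal)) Filter.atTop
        ≤ ((2 * Real.pi * β : ℝ) : EReal)) := by
  have he : ∀ x, (S.e u₀ x : ℝ) ≤ e₀ := fun x => he₀.1 ⟨x, rfl⟩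
  have hb : ∀ t x, (S.b (S.e (S.Φ t u₀) x) : ℝ) ≤ β := fun t x => hβ.1 ⟨(x, t), rfl⟩
  have hlog := Real.tendsto_log_atTop
  refine ⟨fun R₀ γ hR₀ _ hγ => ?_, fun R₀ hR₀ => ?_⟩
  · have hR : ∀ᶠ T : ℝ in atTop, 0 < R₀ * T ^ γ := by
      filter_upwards [eventually_gt_atTop 0] with T hT using by positivity
    have hγ' : 0 < 1 - 2 * γ := by linarith
    -- Here `log (√T / (R₀ T^γ)) = (1/2 - γ) log T - log R₀`.
    refine (S.limsup_dissipatedEnergy_le u₀ hβ_pos.le he hb (κ := 1 / 2 - γ) (by linarith) hlog hR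
      (tendsto_log_div_of_eq (c := Real.log R₀) hlog hR ?_)).trans_eq ?_
    · filter_upwards [eventually_gt_atTop 0] with T hT
      rw [Real.log_div (by positivity) (by positivity), Real.log_mul hR₀.ne' (by positivity),
        Real.log_sqrt hT.le, Real.log_rpow hT]
      ring
    · rw [show (1 : ℝ) / 2 - γ = (1 - 2 * γ) / 2 by ring]
      congr 1
      field_simp
      norm_num
  · have hR : ∀ᶠ T : ℝ in atTop, 0 < R₀ * √T / Real.log T := by
      filter_upwards [eventually_gt_atTop 0, hlog.eventually_gt_atTop 0] with T hT hT'
      positivity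
    -- Here `√T / R(T) = log T / R₀`, whose logarithm is `log log T - log R₀`.
    refine (S.limsup_dissipatedEnergy_le u₀ hβ_pos.le he hb one_pos (hlog.comp hlog) hR
      (tendsto_log_div_of_eq (c := Real.log R₀) (hlog.comp hlog) hR ?_)).trans_eq (by rw [div_one])
    filter_upwards [eventually_gt_atTop 0, hlog.eventually_gt_atTop 0] with T hT hT'
    rw [show √T / (R₀ * √T / Real.log T) = Real.log T / R₀ by
      have : 0 < √T := by positivity
      field_simp, Real.log_div hT'.ne' hR₀.ne', one_mul, Function.comp]
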